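/- Let $(M,h)$ be a smooth Riemannian surface with a spin structure, let $\Sigma M$ be its (complex rank two) spinor bundle with hermitian product $\langle\cdot,\cdot\rangle$, Clifford multiplication $X\cdot$ and spinor connection $\nabla$, and let $D=\sum_\alpha e_\alpha\cdot\nabla_{e_\alpha}$ be the Dirac operator, where $e_1,e_2$ denotes a positively oriented local orthonormal frame. Put $P_\pm=\tfrac12(1\pm i\,e_1\cdot e_2\cdot)$. Let $\lambda,\kappa\in\mathbb R$, $q\in\mathbb N$, and let $\psi=(\psi^1,\dots,\psi^q)$ be a smooth section of $\Sigma M\otimes\mathbb R^q$ that solves the Gross--Neveu equation $$D\psi^i=\lambda\psi^i+\kappa|\psi|^2\psi^i,\qquad i=1,\dots,q,\qquad |\psi|^2=\sum_{j=1}^q|\psi^j|^2 .$$ Let $(x,y)$ be local coordinates of $M$ with coordinate vector fields $\partial_x,\partial_y$, let $p$ be a point of their domain, and let $J_x,J_y$ be the $q\times q$ matrix-valued functions $J_x^{im}=\langle\psi^i,\partial_x\cdot\psi^m\rangle$, $J_y^{im}=\langle\psi^i,\partial_y\cdot\psi^m\rangle$. (1) If $h(\partial_x,\partial_y)=0$ at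 $p$ (for example, if the coordinates are isothermal) and if the indices $i,m$ are such that at $p$ $$\sum_{j=1}^q|P_-\psi^j|^2\,\langle P_-\psi^i,P_-\psi^m\rangle=\sum_{j=1}^q|P_+\psi^j|^2\,\langle P_+\psi^i,P_+\psi^m\rangle, \qquad(*)$$ then at $p$ $$\partial_xJ_y^{im}-\partial_yJ_x^{im}-\kappa\sum_{j=1}^q\bigl(J_x^{ij}J_y^{jm}-J_y^{ij}J_x^{jm}\bigr)=2\lambda\langle\psi^i,\partial_x\cdot\partial_y\cdot\psi^m\rangle .$$ (2) If $\lambda=0$ and $(*)$ holds at $p$ for all $i,m$, then at $p$, in arbitrary coordinates, $\partial_xJ_y-\partial_yJ_x-\kappa[J_x,J_y]=0$; in particular the connection $d+A$ with $A=-\kappa(J_x\,dx+J_y\,dy)$ has zero curvature at $p$: $\partial_xA_y-\partial_yA_x+[A_x,A_y]=0$. -/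

import Mathlib

open scoped Manifold ContDiff Bundle

noncomputable section

namespace GrossNeveu

/-- The plane on which surfaces are modelled. -/
abbrev Plane : Type := EuclideanSpace ℝ (Fin 2)

/-- The complex spinor module `ℂ²` of the Clifford algebra of the Euclidean plane. -/
abbrev Spinor : Type := Fin 2 → ℂ

/-- Clifford multiplication by the standard orthonormal basis of the plane. -/
def gam : Fin 2 → Matrix (Fin 2) (Fin 2) ℂ :=
  ![!![0, 1; -1, 0], !![0, Complex.I; Complex.I, 0]]

/-- The standard hermitian product on `ℂ²`, linear in the first argument. -/
def herm (φ η : Spinor) : ℂ := ∑ k, φ k * star (η k)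

/-- `|φ|²` for the standard hermitian product. -/
def normSq (φ : Spinor) : ℝ := ∑ k, Complex.normSq (φ k)

/-- The spin representation of `Spin(2) = {cos t + sin t e₁·e₂}`, identified with the unit circle
through `u = cos t + i sin t`, extended real-linearly to all of `ℂ`. -/
def spinRep : ℂ →L[ℝ] Spinor →L[ℝ] Spinor :=
  LinearMap.toContinuousLinearMap
    { toFun := fun u => LinearMap.toContinuousLinearMap
        { toFun := fun φ => u.re • φ + u.im • ((gam 0 * gam 1).mulVec φ)
          map_add' := by
            intro x y
            simp only [Matrix.mulVec_add, smul_add]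
            abel
          map_smul' := by
            intro c x
            simp only [Matrix.mulVec_smul, smul_add, RingHom.id_apply]
            rw [smul_comm c u.re, smul_comm c u.im] }
      map_add' := by
        intro u v
        ext φ : 1
        simp only [LinearMap.coe_toContinuousLinearMap', LinearMap.coe_mk, AddHom.coe_mk,
          add_apply, Complex.add_re, Complex.add_im, add_smul]
        abel
      map_smul' := by
        intro c u
        ext φ : 1
        simp only [LinearMap.coe_toContinuousLinearMap', LinearMap.coe_mk, AddHom.coe_mk,
          smul_apply, Complex.real_smul, Complex.re_ofReal_mul,
          Complex.im_ofReal_mul, RingHom.id_apply, smul_add, mul_smul] }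

theorem spinRep_apply (u : ℂ) (φ : Spinor) :
    spinRep u φ = u.re • φ + u.im • ((gam 0 * gam 1).mulVec φ) := rfl

theorem spinRep_one (φ : Spinor) : spinRep 1 φ = φ := by
  simp [spinRep_apply]

theorem spinRep_mul (u v : ℂ) (φ : Spinor) : spinRep (u * v) φ = spinRep u (spinRep v φ) := by
  have hsq : (gam 0 * gam 1) * (gam 0 * gam 1) = -1 := by
    ext i j
    fin_cases i <;> fin_cases j <;> simp [gam, Matrix.mul_apply, Fin.sum_univ_two]
  simp only [spinRep_apply, Matrix.mulVec_add, Matrix.mulVec_smul, Matrix.mulVec_mulVec, hsq,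
    Matrix.neg_mulVec, Matrix.one_mulVec, Complex.mul_re, Complex.mul_im]
  module

variable {M : Type*} [TopologicalSpace M] [ChartedSpace Plane M] [IsManifold 𝓘(ℝ, Plane) ∞ M]

/-- A smooth Riemannian metric on the surface `M`. -/
abbrev SurfaceMetric (M : Type*) [TopologicalSpace M] [ChartedSpace Plane M]
    [IsManifold 𝓘(ℝ, Plane) ∞ M] : Type _ :=
  Bundle.ContMDiffRiemannianMetric 𝓘(ℝ, Plane) ∞ Plane
    (fun p : M => TangentSpace 𝓘(ℝ, Plane) p)

/-- A spin structure on the Riemannian surface `(M, h)`: a cover of `M` by domains of smooth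
orthonormal frames whose changes of frame are rotations (so that they orient `M`), with a smooth
lift of these rotations through the double cover `Spin(2) → SO(2)`, `u ↦ u²`, that satisfies
the cocycle condition. -/
structure SpinStructure (h : SurfaceMetric M) (ι : Type*) where
  baseSet : ι → Set M
  isOpen_baseSet : ∀ a, IsOpen (baseSet a)
  indexAt : M → ι
  mem_baseSet_at : ∀ p, p ∈ baseSet (indexAt p)
  frame : ι → Fin 2 → (p : M) → TangentSpace 𝓘(ℝ, Plane) p
  contMDiffOn_frame : ∀ a k,
    ContMDiffOn 𝓘(ℝ, Plane) 𝓘(ℝ, Plane).tangent ∞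
      (fun p => (⟨p, frame a k p⟩ : TangentBundle 𝓘(ℝ, Plane) M)) (baseSet a)
  orthonormal : ∀ a, ∀ p ∈ baseSet a, ∀ k l,
    h.inner p (frame a k p) (frame a l p) = if k = l then 1 else 0
  lift : ι → ι → M → Circle
  contMDiffOn_lift : ∀ a b,
    ContMDiffOn 𝓘(ℝ, Plane) 𝓘(ℝ, ℂ) ∞ (fun p => (lift a b p : ℂ)) (baseSet a ∩ baseSet b)
  frame_change_zero : ∀ a b, ∀ p ∈ baseSet a ∩ baseSet b,
    frame b 0 p = ((lift a b p : ℂ) ^ 2).re • frame a 0 p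
      + ((lift a b p : ℂ) ^ 2).im • frame a 1 p
  frame_change_one : ∀ a b, ∀ p ∈ baseSet a ∩ baseSet b,
    frame b 1 p = (-((lift a b p : ℂ) ^ 2).im) • frame a 0 p
      + ((lift a b p : ℂ) ^ 2).re • frame a 1 p
  lift_comp : ∀ a b c, ∀ p ∈ baseSet a ∩ baseSet b ∩ baseSet c,
    lift a b p * lift b c p = lift a c p

namespace SpinStructure

variable {h : SurfaceMetric M} {ι : Type*} (S : SpinStructure h ι)

theorem lift_self (a : ι) (p : M) (hp : p ∈ S.baseSet a) : S.lift a a p = 1 := by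
  have := S.lift_comp a a a p ⟨⟨hp, hp⟩, hp⟩
  simpa using this

/-- The spinor bundle `ΣM`, associated to the spin structure by the spin representation. The
components `φ_a`, `φ_b` of a spinor in the trivializations `a`, `b` satisfy
`φ_b = spinRep (lift b a) φ_a`. -/
def spinorBundle : VectorBundleCore ℝ M Spinor ι where
  baseSet := S.baseSet
  isOpen_baseSet := S.isOpen_baseSet
  indexAt := S.indexAt
  mem_baseSet_at := S.mem_baseSet_at
  coordChange a b p := spinRep (S.lift b a p : ℂ)
  coordChange_self a p hp v := by
    rw [S.lift_self a p hp, Circle.coe_one, spinRep_one]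
  continuousOn_coordChange a b := by
    refine spinRep.continuous.comp_continuousOn ?_
    rw [Set.inter_comm]
    exact (S.contMDiffOn_lift b a).continuousOn
  coordChange_comp a b c p hp v := by
    rw [← spinRep_mul, ← Circle.coe_mul, S.lift_comp c b a p ⟨⟨hp.2, hp.1.2⟩, hp.1.1⟩]

instance : S.spinorBundle.IsContMDiff 𝓘(ℝ, Plane) ∞ where
  contMDiffOn_coordChange a b := by
    have h1 := S.contMDiffOn_lift b a
    rw [Set.inter_comm] at h1
    exact spinRep.contMDiff.comp_contMDiffOn h1

/-- Smooth sections of the spinor bundle, that is `Γ(ΣM)`. -/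
abbrev SpinorField : Type _ :=
  ContMDiffSection 𝓘(ℝ, Plane) Spinor ∞ S.spinorBundle.Fiber

variable {S}

/-- The `ℂ²`-valued function that represents a spinor field in the trivialization `a`. -/
def comp (a : ι) (ψ : S.SpinorField) (p : M) : Spinor :=
  (S.spinorBundle.localTriv a ⟨p, ψ p⟩).2

/-- The value at `p` of a spinor field; the fibre of `ΣM` over `p` is identified with `ℂ²` by the
preferred trivialization at `p`. -/
def val (ψ : S.SpinorField) (p : M) : Spinor := comp (S.indexAt p) ψ p

variable (S)

/-- Clifford multiplication `X · φ` of a spinor at `p` by a tangent vector at `p`. -/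
def cliff (p : M) (X : TangentSpace 𝓘(ℝ, Plane) p) (φ : Spinor) : Spinor :=
  ∑ k, h.inner p X (S.frame (S.indexAt p) k p) • (gam k).mulVec φ

/-- The Levi-Civita connection form `X ↦ h(∇_X e₁, e₂)` of the orthonormal frame `e₁, e₂` with
index `a`. As `∇` is metric and torsion-free, `[e₁, e₂] = ∇_{e₁} e₂ - ∇_{e₂} e₁ =
-h(∇_{e₁} e₁, e₂) e₁ - h(∇_{e₂} e₁, e₂) e₂`, so that `h(∇_X e₁, e₂) = -h([e₁, e₂], X)`. -/
def connForm (a : ι) (p : M) (X : TangentSpace 𝓘(ℝ, Plane) p) : ℝ :=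
  - h.inner p (VectorField.mlieBracket 𝓘(ℝ, Plane) (S.frame a 0) (S.frame a 1) p) X

variable {S}

/-- The spinor connection `∇_X ψ = X(ψ) + ½ h(∇_X e₁, e₂) e₁ · e₂ · ψ`. -/
def nabla (ψ : S.SpinorField) (p : M) (X : TangentSpace 𝓘(ℝ, Plane) p) : Spinor :=
  (show Spinor from mfderiv 𝓘(ℝ, Plane) 𝓘(ℝ, Spinor) (comp (S.indexAt p) ψ) p X)
    + (S.connForm (S.indexAt p) p X / 2) • (gam 0 * gam 1).mulVec (val ψ p)

/-- The Dirac operator `∑ₖ eₖ · ∇_{eₖ} ψ`. -/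
def dirac (ψ : S.SpinorField) (p : M) : Spinor :=
  ∑ k, S.cliff p (S.frame (S.indexAt p) k p) (nabla ψ p (S.frame (S.indexAt p) k p))

variable (S)

/-- The complex volume element `i e₁ · e₂` acting on spinors at `p`. -/
def volumeElement (p : M) (φ : Spinor) : Spinor :=
  Complex.I • S.cliff p (S.frame (S.indexAt p) 0 p) (S.cliff p (S.frame (S.indexAt p) 1 p) φ)

/-- The projector `P₊ = ½ (1 + i e₁ · e₂)`. -/
def projPlus (p : M) (φ : Spinor) : Spinor := (1 / 2 : ℂ) • (φ + S.volumeElement p φ)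

/-- The projector `P₋ = ½ (1 - i e₁ · e₂)`. -/
def projMinus (p : M) (φ : Spinor) : Spinor := (1 / 2 : ℂ) • (φ - S.volumeElement p φ)

variable {S}

/-- `|ψ|² = ∑ⱼ |ψʲ|²` for a section `ψ = (ψ¹, …, ψ^q)` of `ΣM ⊗ ℝ^q`. -/
def totalNormSq {q : ℕ} (ψ : Fin q → S.SpinorField) (p : M) : ℝ :=
  ∑ j, normSq (val (ψ j) p)

/-- The Gross-Neveu equation `D ψⁱ = lam ψⁱ + κ |ψ|² ψⁱ` on `M`. -/
def IsGrossNeveuSolution {q : ℕ} (lam κ : ℝ) (ψ : Fin q → S.SpinorField) : Prop :=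
  ∀ i p, dirac (ψ i) p = lam • val (ψ i) p + (κ * totalNormSq ψ p) • val (ψ i) p

/-- The condition `|P₋ψʲ|² ⟨P₋ψⁱ, P₋ψᵐ⟩ = |P₊ψʲ|² ⟨P₊ψⁱ, P₊ψᵐ⟩` at the point `p`, with summation
over `j`. -/
def MajoranaAt {q : ℕ} (ψ : Fin q → S.SpinorField) (i m : Fin q) (p : M) : Prop :=
  ((∑ j, normSq (S.projMinus p (val (ψ j) p)) : ℝ) : ℂ)
      * herm (S.projMinus p (val (ψ i) p)) (S.projMinus p (val (ψ m) p))
    = ((∑ j, normSq (S.projPlus p (val (ψ j) p)) : ℝ) : ℂ)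
      * herm (S.projPlus p (val (ψ i) p)) (S.projPlus p (val (ψ m) p))

end SpinStructure

/-- The coordinate vector field `∂ₖ` of a chart `c` of `M`. -/
def coordField (c : OpenPartialHomeomorph M Plane) (k : Fin 2) (p : M) :
    TangentSpace 𝓘(ℝ, Plane) p :=
  VectorField.mpullback 𝓘(ℝ, Plane) 𝓘(ℝ, Plane) c
    (fun _ => (EuclideanSpace.single k 1 : Plane)) p

/-- The partial derivative `∂ₖ f` of a function on `M` in the chart `c`. -/
def partialDeriv (c : OpenPartialHomeomorph M Plane) (k : Fin 2) (f : M → ℂ) (p : M) : ℂ :=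
  fderiv ℝ (f ∘ c.symm) (c p) (EuclideanSpace.single k 1)

/-- The entrywise partial derivative of a matrix-valued function. -/
def matrixDeriv {q : ℕ} (c : OpenPartialHomeomorph M Plane) (k : Fin 2)
    (A : M → Matrix (Fin q) (Fin q) ℂ) (p : M) : Matrix (Fin q) (Fin q) ℂ :=
  Matrix.of fun i m => partialDeriv c k (fun r => A r i m) p

/-- The curvature `∂ₓA_y - ∂_yAₓ + [Aₓ, A_y]` in the chart `c` of the connection `d + A`, where
`A 0` and `A 1` are the components of the matrix-valued one-form in the chart. -/
def curvature {q : ℕ} (c : OpenPartialHomeomorph M Plane)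
    (A : Fin 2 → M → Matrix (Fin q) (Fin q) ℂ) (p : M) : Matrix (Fin q) (Fin q) ℂ :=
  matrixDeriv c 0 (A 1) p - matrixDeriv c 1 (A 0) p + (A 0 p * A 1 p - A 1 p * A 0 p)

/-- The component in direction `k`, in the chart `c`, of the Noether current
`Jⁱᵐ(X) = ⟨ψⁱ, X · ψᵐ⟩`. -/
def current {h : SurfaceMetric M} {ι : Type*} {S : SpinStructure h ι} {q : ℕ}
    (ψ : Fin q → S.SpinorField) (c : OpenPartialHomeomorph M Plane) (k : Fin 2) (p : M) :
    Matrix (Fin q) (Fin q) ℂ :=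
  Matrix.of fun i m =>
    herm (SpinStructure.val (ψ i) p) (S.cliff p (coordField c k p) (SpinStructure.val (ψ m) p))

end GrossNeveu

end

/-!
Since `e₁ · e₂ · D = e₂ · ∇_{e₁} - e₁ · ∇_{e₂}` and Clifford multiplication by vectors is skew, the
exterior derivative of the one-form `X ↦ ⟨φ, X · η⟩` is
`(⟨Dφ, e₁ · e₂ · η⟩ + ⟨φ, e₁ · e₂ · Dη⟩) e¹ ∧ e²` for all spinor fields `φ` and `η`. For a solution
of the Gross-Neveu equation this equals `2 (λ + κ |ψ|²) ⟨ψⁱ, e₁ · e₂ · ψᵐ⟩ e¹ ∧ e²`. A Fierz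
identity for spinors of rank two writes the commutator of the currents as
`(2 |ψ|² ⟨ψⁱ, e₁ · e₂ · ψᵐ⟩ + 2 i δⁱᵐ) e¹ ∧ e²`, where `δⁱᵐ` is the difference of the two sides of
the condition `(*)`, so that the cubic terms cancel wherever `δⁱᵐ` vanishes.
-/

noncomputable section

namespace GrossNeveu

section SpinorAlgebra

open Matrix

theorem herm_eq_dotProduct (φ η : Spinor) : herm φ η = φ ⬝ᵥ star η := rfl

theorem herm_add_left (φ φ' η : Spinor) : herm (φ + φ') η = herm φ η + herm φ' η :=
  add_dotProduct φ φ' (star η)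

theorem herm_add_right (φ η η' : Spinor) : herm φ (η + η') = herm φ η + herm φ η' := by
  simp only [herm_eq_dotProduct, star_add, dotProduct_add]

theorem herm_smul_left (s : ℝ) (φ η : Spinor) : herm (s • φ) η = s * herm φ η := by
  simp only [herm_eq_dotProduct, smul_dotProduct, Complex.real_smul]

theorem herm_smul_right (s : ℝ) (φ η : Spinor) : herm φ (s • η) = s * herm φ η := by
  simp only [herm_eq_dotProduct, star_smul, star_trivial, dotProduct_smul, Complex.real_smul]

theorem herm_neg_right (φ η : Spinor) : herm φ (-η) = -herm φ η := by
  simp only [herm_eq_dotProduct, star_neg, dotProduct_neg]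

theorem herm_mulVec_left (A : Matrix (Fin 2) (Fin 2) ℂ) (φ η : Spinor) :
    herm (A *ᵥ φ) η = herm φ (Aᴴ *ᵥ η) := by
  rw [herm_eq_dotProduct, herm_eq_dotProduct, star_mulVec, conjTranspose_conjTranspose,
    dotProduct_comm, dotProduct_mulVec, dotProduct_comm]

/-- The real-bilinear map `(φ, η) ↦ ⟨φ, A η⟩`. -/
def hermForm (A : Matrix (Fin 2) (Fin 2) ℂ) : Spinor →L[ℝ] Spinor →L[ℝ] ℂ :=
  LinearMap.toContinuousBilinearMap <| LinearMap.mk₂ ℝ (fun φ η => herm φ (A *ᵥ η))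
    (fun _ _ _ => herm_add_left _ _ _)
    (fun _ _ _ => herm_smul_left _ _ _)
    (fun _ _ _ => by rw [mulVec_add, herm_add_right])
    (fun _ _ _ => by rw [mulVec_smul, herm_smul_right, Complex.real_smul])

theorem hermForm_apply (A : Matrix (Fin 2) (Fin 2) ℂ) (φ η : Spinor) :
    hermForm A φ η = herm φ (A *ᵥ η) := rfl

theorem gam_mul_self (k : Fin 2) : gam k * gam k = -1 := by
  ext i j
  fin_cases k <;> fin_cases i <;> fin_cases j <;> simp [gam, mul_apply]

theorem gam_one_mul_gam_zero : gam 1 * gam 0 = -(gam 0 * gam 1) := by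
  ext i j
  fin_cases i <;> fin_cases j <;> simp [gam, mul_apply]

theorem conjTranspose_gam (k : Fin 2) : (gam k)ᴴ = -gam k := by
  ext i j
  fin_cases k <;> fin_cases i <;> fin_cases j <;> simp [gam]

theorem gam_zero_mul_gam_zero_mul_gam_one : gam 0 * (gam 0 * gam 1) = -gam 1 := by
  rw [← mul_assoc, gam_mul_self, neg_one_mul]

theorem gam_zero_mul_gam_one_mul_gam_one : gam 0 * gam 1 * gam 1 = -gam 0 := by
  rw [mul_assoc, gam_mul_self, mul_neg_one]

theorem gam_zero_mul_gam_one_mul_gam_zero : gam 0 * gam 1 * gam 0 = gam 1 := by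
  rw [mul_assoc, gam_one_mul_gam_zero, mul_neg, gam_zero_mul_gam_zero_mul_gam_one, neg_neg]

theorem gam_one_mul_gam_zero_mul_gam_one : gam 1 * (gam 0 * gam 1) = gam 0 := by
  rw [← mul_assoc, gam_one_mul_gam_zero, neg_mul, gam_zero_mul_gam_one_mul_gam_one, neg_neg]

theorem herm_gam_mulVec_left (k : Fin 2) (φ η : Spinor) :
    herm (gam k *ᵥ φ) η = -herm φ (gam k *ᵥ η) := by
  rw [herm_mulVec_left, conjTranspose_gam, neg_mulVec, herm_neg_right]

theorem herm_gam_mul_gam_mulVec_left (x y : Spinor) :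
    herm ((gam 0 * gam 1) *ᵥ x) y = -herm x ((gam 0 * gam 1) *ᵥ y) := by
  rw [← mulVec_mulVec, herm_gam_mulVec_left, herm_gam_mulVec_left, mulVec_mulVec,
    gam_one_mul_gam_zero, neg_mulVec, herm_neg_right, neg_neg]

theorem herm_curl (x y : Spinor) (X Y : Fin 2 → Spinor) :
    herm (∑ k, gam k *ᵥ X k) ((gam 0 * gam 1) *ᵥ y)
        + herm x ((gam 0 * gam 1) *ᵥ ∑ k, gam k *ᵥ Y k)
      = herm (X 0) (gam 1 *ᵥ y) + herm x (gam 1 *ᵥ Y 0)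
        - (herm (X 1) (gam 0 *ᵥ y) + herm x (gam 0 *ᵥ Y 1)) := by
  simp only [Fin.sum_univ_two, herm_add_left, herm_gam_mulVec_left, mulVec_add, herm_add_right,
    mulVec_mulVec, gam_zero_mul_gam_zero_mul_gam_one, gam_one_mul_gam_zero_mul_gam_one,
    gam_zero_mul_gam_one_mul_gam_zero, gam_zero_mul_gam_one_mul_gam_one, neg_mulVec,
    herm_neg_right]
  ring

theorem herm_curl_connection (x y : Spinor) (X Y : Fin 2 → Spinor) (w : Fin 2 → ℝ) :
    herm (∑ k, gam k *ᵥ (X k + (w k / 2) • (gam 0 * gam 1) *ᵥ x)) ((gam 0 * gam 1) *ᵥ y)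
        + herm x ((gam 0 * gam 1) *ᵥ ∑ k, gam k *ᵥ (Y k + (w k / 2) • (gam 0 * gam 1) *ᵥ y))
      = herm (X 0) (gam 1 *ᵥ y) + herm x (gam 1 *ᵥ Y 0)
        - (herm (X 1) (gam 0 *ᵥ y) + herm x (gam 0 *ᵥ Y 1))
        + ∑ k, w k * herm x (gam k *ᵥ y) := by
  rw [herm_curl]
  simp only [Fin.sum_univ_two, herm_add_left, herm_add_right, herm_smul_left, herm_smul_right,
    herm_gam_mul_gam_mulVec_left, mulVec_add, mulVec_smul, mulVec_mulVec,
    gam_zero_mul_gam_zero_mul_gam_one, gam_one_mul_gam_zero_mul_gam_one,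
    gam_zero_mul_gam_one_mul_gam_zero, gam_zero_mul_gam_one_mul_gam_one, neg_mulVec,
    herm_neg_right, Complex.ofReal_div, Complex.ofReal_ofNat]
  ring

theorem herm_spinRep_left (u : ℂ) (x y : Spinor) :
    herm (spinRep u x) y = herm x (spinRep (star u) y) := by
  simp only [spinRep_apply, herm_add_left, herm_add_right, herm_smul_left, herm_smul_right,
    herm_gam_mul_gam_mulVec_left, Complex.star_def, Complex.conj_re, Complex.conj_im,
    Complex.ofReal_neg]
  ring

theorem gam_mul_gam_zero_mul_gam_one (k : Fin 2) :
    gam k * (gam 0 * gam 1) = -(gam 0 * gam 1 * gam k) := by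
  fin_cases k
  · rw [Fin.zero_eta, gam_zero_mul_gam_zero_mul_gam_one, gam_zero_mul_gam_one_mul_gam_zero]
  · rw [Fin.mk_one, gam_one_mul_gam_zero_mul_gam_one, gam_zero_mul_gam_one_mul_gam_one, neg_neg]

theorem gam_mulVec_spinRep (k : Fin 2) (u : ℂ) (φ : Spinor) :
    gam k *ᵥ spinRep u φ = spinRep (star u) (gam k *ᵥ φ) := by
  simp only [spinRep_apply, mulVec_add, mulVec_smul, mulVec_mulVec,
    gam_mul_gam_zero_mul_gam_one, neg_mulVec, Complex.star_def, Complex.conj_re,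
    Complex.conj_im, neg_smul, smul_neg]

theorem herm_spinRep_gam_mulVec_spinRep (k : Fin 2) (u : ℂ) (x y : Spinor) :
    herm (spinRep u x) (gam k *ᵥ spinRep u y) = herm x (gam k *ᵥ spinRep (u ^ 2) y) := by
  rw [herm_spinRep_left, gam_mulVec_spinRep, ← spinRep_mul, gam_mulVec_spinRep, star_pow, pow_two]

theorem gam_zero_mulVec_spinRep (u : ℂ) (φ : Spinor) :
    gam 0 *ᵥ spinRep u φ = u.re • gam 0 *ᵥ φ - u.im • gam 1 *ᵥ φ := by
  rw [spinRep_apply, mulVec_add, mulVec_smul, mulVec_smul, mulVec_mulVec,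
    gam_zero_mul_gam_zero_mul_gam_one, neg_mulVec, smul_neg, sub_eq_add_neg]

theorem gam_one_mulVec_spinRep (u : ℂ) (φ : Spinor) :
    gam 1 *ᵥ spinRep u φ = u.re • gam 1 *ᵥ φ + u.im • gam 0 *ᵥ φ := by
  rw [spinRep_apply, mulVec_add, mulVec_smul, mulVec_smul, mulVec_mulVec,
    gam_one_mul_gam_zero_mul_gam_one]

theorem gam_zero_mulVec (φ : Spinor) : gam 0 *ᵥ φ = ![φ 1, -φ 0] := by
  ext k; fin_cases k <;> simp [gam, mulVec, dotProduct]

theorem gam_one_mulVec (φ : Spinor) :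
    gam 1 *ᵥ φ = ![Complex.I * φ 1, Complex.I * φ 0] := by
  ext k; fin_cases k <;> simp [gam, mulVec, dotProduct]

theorem gam_commutator_fierz (x y z : Spinor) :
    herm x (gam 0 *ᵥ z) * herm z (gam 1 *ᵥ y) - herm x (gam 1 *ᵥ z) * herm z (gam 0 *ᵥ y)
      = 2 * normSq z * herm x ((gam 0 * gam 1) *ᵥ y)
        + 2 * Complex.I * (Complex.normSq (z 0) * (x 0 * star (y 0))
          - Complex.normSq (z 1) * (x 1 * star (y 1))) := by
  rw [← mulVec_mulVec]
  simp only [herm, normSq, gam_zero_mulVec, gam_one_mulVec, Fin.sum_univ_two,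
    Complex.ofReal_add, ← Complex.mul_conj]
  simp only [Matrix.cons_val_zero, Matrix.cons_val_one, Matrix.cons_val_fin_one,
    RCLike.star_def, star_neg, mul_neg, star_mul', Complex.conj_I, neg_mul, neg_neg]
  ring

end SpinorAlgebra

section VectorFields

open VectorField

variable {𝕜 : Type*} [NontriviallyNormedField 𝕜] {E : Type*} [NormedAddCommGroup E]
  [NormedSpace 𝕜 E] {H : Type*} [TopologicalSpace H] {I : ModelWithCorners 𝕜 E H}
  {M : Type*} [TopologicalSpace M] [ChartedSpace H M] {p : M}

theorem mdifferentiableAt_bilinear {F G W : Type*} [NormedAddCommGroup F] [NormedSpace 𝕜 F]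
    [NormedAddCommGroup G] [NormedSpace 𝕜 G] [NormedAddCommGroup W] [NormedSpace 𝕜 W]
    (B : F →L[𝕜] G →L[𝕜] W) {f : M → F} {g : M → G} (hf : MDiffAt f p) (hg : MDiffAt g p) :
    MDiffAt (fun r => B (f r) (g r)) p :=
  (mdifferentiableAt_const.clm_apply hf).clm_apply hg

theorem mvfderiv_bilinear {F G W : Type*} [NormedAddCommGroup F] [NormedSpace 𝕜 F]
    [NormedAddCommGroup G] [NormedSpace 𝕜 G] [NormedAddCommGroup W] [NormedSpace 𝕜 W]
    (B : F →L[𝕜] G →L[𝕜] W) {f : M → F} {g : M → G} (hf : MDiffAt f p) (hg : MDiffAt g p)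
    (v : TangentSpace I p) :
    d% (fun r => B (f r) (g r)) p v = B (d% f p v) (g p) + B (f p) (d% g p v) := by
  have hB : HasMFDerivAt 𝓘(𝕜, F × G) 𝓘(𝕜, W) (fun x : F × G => B x.1 x.2) (f p, g p)
      (B.isBoundedBilinearMap.deriv (f p, g p)) :=
    (B.isBoundedBilinearMap.hasFDerivAt _).hasMFDerivAt
  have hfg : HasMFDerivAt I 𝓘(𝕜, F × G) (fun r => (f r, g r)) p
      ((mfderiv I 𝓘(𝕜, F) f p).prod (mfderiv I 𝓘(𝕜, G) g p)) :=
    ⟨hf.continuousAt.prodMk hg.continuousAt, hf.hasMFDerivAt.2.prodMk hg.hasMFDerivAt.2⟩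
  exact (congrArg (fun L => L v) (HasMFDerivAt.comp p hB hfg).mfderiv).trans (add_comm _ _)

theorem mlieBracket_linearCombination [CompleteSpace E] [IsManifold I (minSmoothness 𝕜 2) M]
    {V W : (r : M) → TangentSpace I r} {f₀ f₁ g₀ g₁ : M → 𝕜} (hV : MDiffAt (T% V) p)
    (hW : MDiffAt (T% W) p) (hf₀ : MDiffAt f₀ p) (hf₁ : MDiffAt f₁ p) (hg₀ : MDiffAt g₀ p)
    (hg₁ : MDiffAt g₁ p) :
    mlieBracket I (f₀ • V + f₁ • W) (g₀ • V + g₁ • W) p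
      = (d% g₀ p (f₀ p • V p + f₁ p • W p) - d% f₀ p (g₀ p • V p + g₁ p • W p)) • V p
        + (d% g₁ p (f₀ p • V p + f₁ p • W p) - d% f₁ p (g₀ p • V p + g₁ p • W p)) • W p
        + (f₀ p * g₁ p - f₁ p * g₀ p) • mlieBracket I V W p := by
  rw [mlieBracket_add_left (hf₀.smul_section hV) (hf₁.smul_section hW),
    mlieBracket_smul_left hf₀ hV, mlieBracket_smul_left hf₁ hW,
    mlieBracket_add_right (hg₀.smul_section hV) (hg₁.smul_section hW),
    mlieBracket_add_right (hg₀.smul_section hV) (hg₁.smul_section hW),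
    mlieBracket_smul_right hg₀ hV, mlieBracket_smul_right hg₁ hW,
    mlieBracket_smul_right hg₀ hV, mlieBracket_smul_right hg₁ hW,
    mlieBracket_swap_apply (V := W) (W := V)]
  simp only [Pi.add_apply, Pi.smul_apply', map_add, map_smul, mlieBracket_self, Pi.zero_apply,
    smul_eq_mul]
  module

/-- The constant vector field on a vector space with value `v`. -/
def constField (v : E) (x : E) : TangentSpace 𝓘(𝕜, E) x := v

theorem mdifferentiableAt_constField (v x : E) :
    MDiffAt (T% (constField (𝕜 := 𝕜) v)) x :=
  ((contMDiffAt_vectorSpace_iff_contDiffAt (n := 1) (V := constField v)).2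
    (contDiffAt_const (c := v))).mdifferentiableAt one_ne_zero

theorem mlieBracket_constField (v w x : E) :
    mlieBracket 𝓘(𝕜, E) (constField v) (constField w) x = 0 := by
  rw [← mlieBracketWithin_univ, mlieBracketWithin_eq_lieBracketWithin]
  change fderivWithin 𝕜 (fun _ : E => w) Set.univ x v
    - fderivWithin 𝕜 (fun _ : E => v) Set.univ x w = 0
  simp only [fderivWithin_fun_const, Pi.zero_apply, zero_apply, sub_zero]

section Chart

variable {M : Type*} [TopologicalSpace M] [ChartedSpace E M] {n : ℕ∞ω}
  {c : OpenPartialHomeomorph M E} {p : M}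

theorem mdifferentiable_of_mem_maximalAtlas (hc : c ∈ IsManifold.maximalAtlas 𝓘(𝕜, E) n M)
    (hn : n ≠ 0) : c.MDifferentiable 𝓘(𝕜, E) 𝓘(𝕜, E) :=
  ⟨(contMDiffOn_of_mem_maximalAtlas hc).mdifferentiableOn hn,
    (contMDiffOn_symm_of_mem_maximalAtlas hc).mdifferentiableOn hn⟩

theorem mpullback_constField (hc : c.MDifferentiable 𝓘(𝕜, E) 𝓘(𝕜, E)) (hp : p ∈ c.source)
    (v : E) :
    mpullback 𝓘(𝕜, E) 𝓘(𝕜, E) c (constField v) p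
      = mfderiv 𝓘(𝕜, E) 𝓘(𝕜, E) c.symm (c p) (constField v (c p)) :=
  congrArg (fun L => L v) (ContinuousLinearMap.inverse_equiv (hc.mfderiv hp))

theorem mvfderiv_mpullback_constField {F : Type*} [NormedAddCommGroup F] [NormedSpace 𝕜 F]
    (hc : c.MDifferentiable 𝓘(𝕜, E) 𝓘(𝕜, E)) (hp : p ∈ c.source) {f : M → F}
    (hf : MDifferentiableAt 𝓘(𝕜, E) 𝓘(𝕜, F) f p) (v : E) :
    mvfderiv 𝓘(𝕜, E) f p (mpullback 𝓘(𝕜, E) 𝓘(𝕜, E) c (constField v) p)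
      = fderiv 𝕜 (f ∘ c.symm) (c p) v := by
  have hcomp := mfderiv_comp_apply_of_eq (c p) hf
    (hc.mdifferentiableAt_symm (c.map_source hp)) (c.left_inv hp) (constField v (c p))
  rw [mpullback_constField hc hp]
  exact hcomp.symm.trans (DFunLike.congr_fun mfderiv_eq_fderiv v)

theorem mdifferentiableAt_mpullback_constField [CompleteSpace E] [IsManifold 𝓘(𝕜, E) 2 M]
    (hc : c ∈ IsManifold.maximalAtlas 𝓘(𝕜, E) n M) (hn : 2 ≤ n) (hp : p ∈ c.source) (v : E) :
    MDiffAt (T% (mpullback 𝓘(𝕜, E) 𝓘(𝕜, E) c (constField v))) p :=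
  (mdifferentiableAt_constField v (c p)).mpullback_vectorField
    (contMDiffAt_of_mem_maximalAtlas hc hp)
    ⟨(mdifferentiable_of_mem_maximalAtlas hc (two_pos.trans_le hn).ne').mfderiv hp, rfl⟩ hn

theorem mlieBracket_mpullback_constField [CompleteSpace E]
    [IsManifold 𝓘(𝕜, E) (minSmoothness 𝕜 2) M]
    (hc : c ∈ IsManifold.maximalAtlas 𝓘(𝕜, E) n M) (hn : minSmoothness 𝕜 2 ≤ n) (hp : p ∈ c.source)
    (v w : E) :
    mlieBracket 𝓘(𝕜, E) (mpullback 𝓘(𝕜, E) 𝓘(𝕜, E) c (constField v))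
      (mpullback 𝓘(𝕜, E) 𝓘(𝕜, E) c (constField w)) p = 0 := by
  rw [← mpullback_mlieBracket (mdifferentiableAt_constField v (c p))
    (mdifferentiableAt_constField w (c p)) (contMDiffAt_of_mem_maximalAtlas hc hp) hn,
    mpullback_apply, mlieBracket_constField, map_zero]

end Chart

end VectorFields

section Metric

theorem mdifferentiableAt_riemannianMetric_inner {EB : Type*} [NormedAddCommGroup EB]
    [NormedSpace ℝ EB] {HB : Type*} [TopologicalSpace HB] {IB : ModelWithCorners ℝ EB HB} {n : ℕ∞ω}
    {B : Type*} [TopologicalSpace B] [ChartedSpace HB B]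
    {F : Type*} [NormedAddCommGroup F] [NormedSpace ℝ F]
    {E : B → Type*} [TopologicalSpace (Bundle.TotalSpace F E)] [∀ b, AddCommGroup (E b)]
    [∀ b, TopologicalSpace (E b)] [∀ b, Module ℝ (E b)] [∀ b, IsTopologicalAddGroup (E b)]
    [∀ b, ContinuousConstSMul ℝ (E b)] [FiberBundle F E] [VectorBundle ℝ F E]
    (g : Bundle.ContMDiffRiemannianMetric IB n F E) (hn : n ≠ 0)
    {V W : ∀ b, E b} {p : B} (hV : MDiffAt (T% V) p) (hW : MDiffAt (T% W) p) :
    MDiffAt (fun r => g.inner r (V r) (W r)) p := by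
  have h : MDifferentiableAt IB (IB.prod 𝓘(ℝ)) (fun r => Bundle.TotalSpace.mk' ℝ
      (E := Bundle.Trivial B ℝ) r (g.inner r (V r) (W r))) p :=
    ((g.contMDiff p).mdifferentiableAt hn).clm_bundle_apply₂ hV hW
  exact ((mdifferentiableAt_totalSpace ..).1 h).2

theorem eq_sum_smul_of_orthonormal {K V ι : Type*} [Field K] [AddCommGroup V] [Module K V]
    [FiniteDimensional K V] [Fintype ι] [DecidableEq ι] (B : V →ₗ[K] V →ₗ[K] K) {e : ι → V}
    (he : ∀ i j, B (e i) (e j) = if i = j then 1 else 0)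
    (hcard : Fintype.card ι = Module.finrank K V) (x : V) : x = ∑ i, B x (e i) • e i := by
  have hli : LinearIndependent K e := by
    rw [Fintype.linearIndependent_iff]
    intro g hg i
    simpa [he] using congrArg (B · (e i)) hg
  have hspan := hli.span_eq_top_of_card_eq_finrank' hcard
  obtain ⟨g, rfl⟩ := (Submodule.mem_span_range_iff_exists_fun K).1
    (hspan ▸ Submodule.mem_top (x := x))
  simp [he]

end Metric

section Charts

open VectorField

variable {M : Type*} [TopologicalSpace M] {q : ℕ} (c : OpenPartialHomeomorph M Plane)

theorem matrixDeriv_const_smul (k : Fin 2) (z : ℂ) (A : M → Matrix (Fin q) (Fin q) ℂ) (p : M) :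
    matrixDeriv c k (fun r => z • A r) p = z • matrixDeriv c k A p := by
  ext i m
  exact DFunLike.congr_fun (congrFun (fderiv_const_smul_field (𝕜 := ℝ)
    (f := (fun r => A r i m) ∘ c.symm) z) (c p)) (EuclideanSpace.single k 1)

theorem curvature_neg_smul (z : ℂ) (A : Fin 2 → M → Matrix (Fin q) (Fin q) ℂ) (p : M) :
    curvature c (fun k r => -z • A k r) p
      = -z • (matrixDeriv c 0 (A 1) p - matrixDeriv c 1 (A 0) p
        - z • (A 0 p * A 1 p - A 1 p * A 0 p)) := by
  simp only [curvature, matrixDeriv_const_smul, smul_mul_assoc, mul_smul_comm]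
  module

variable {c} [ChartedSpace Plane M] [IsManifold 𝓘(ℝ, Plane) ∞ M] {p : M}

instance isManifold_minSmoothness_two : IsManifold 𝓘(ℝ, Plane) (minSmoothness ℝ 2) M := by
  rw [minSmoothness_of_isRCLikeNormedField]
  infer_instance

theorem mdifferentiableAt_coordField (hc : c ∈ IsManifold.maximalAtlas 𝓘(ℝ, Plane) ∞ M)
    (hp : p ∈ c.source) (k : Fin 2) :
    MDifferentiableAt 𝓘(ℝ, Plane) 𝓘(ℝ, Plane).tangent (T% (coordField c k)) p :=
  mdifferentiableAt_mpullback_constField hc (WithTop.coe_le_coe.2 le_top) hp _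

theorem mlieBracket_coordField (hc : c ∈ IsManifold.maximalAtlas 𝓘(ℝ, Plane) ∞ M)
    (hp : p ∈ c.source) (k l : Fin 2) :
    mlieBracket 𝓘(ℝ, Plane) (coordField c k) (coordField c l) p = 0 :=
  mlieBracket_mpullback_constField hc
    (minSmoothness_of_isRCLikeNormedField.trans_le (WithTop.coe_le_coe.2 le_top)) hp _ _

end Charts

variable {M : Type*} [TopologicalSpace M] [ChartedSpace Plane M] [IsManifold 𝓘(ℝ, Plane) ∞ M]

namespace SpinStructure

open VectorField
open scoped Matrix

variable {h : SurfaceMetric M} {ι : Type*} (S : SpinStructure h ι) {a : ι} {p : M}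

theorem mdifferentiableAt_frame (hp : p ∈ S.baseSet a) (k : Fin 2) :
    MDifferentiableAt 𝓘(ℝ, Plane) 𝓘(ℝ, Plane).tangent (T% (S.frame a k)) p :=
  ((S.contMDiffOn_frame a k).contMDiffAt ((S.isOpen_baseSet a).mem_nhds hp)).mdifferentiableAt
    (by simp)

theorem eq_sum_inner_smul_frame (hp : p ∈ S.baseSet a) (X : TangentSpace 𝓘(ℝ, Plane) p) :
    X = ∑ k, h.inner p X (S.frame a k p) • S.frame a k p := by
  have : FiniteDimensional ℝ (TangentSpace 𝓘(ℝ, Plane) p) :=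
    inferInstanceAs (FiniteDimensional ℝ Plane)
  have hcard : Fintype.card (Fin 2) = Module.finrank ℝ (TangentSpace 𝓘(ℝ, Plane) p) :=
    (finrank_euclideanSpace (𝕜 := ℝ) (ι := Fin 2)).symm
  exact eq_sum_smul_of_orthonormal (h.inner p).toLinearMap₁₂ (S.orthonormal a p hp) hcard X

/-- The area form `e¹ ∧ e²` of the orthonormal frame with index `a`. -/
def areaForm (a : ι) (p : M) (X Y : TangentSpace 𝓘(ℝ, Plane) p) : ℝ :=
  h.inner p X (S.frame a 0 p) * h.inner p Y (S.frame a 1 p)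
    - h.inner p X (S.frame a 1 p) * h.inner p Y (S.frame a 0 p)

theorem inner_eq_sum (hp : p ∈ S.baseSet a) (X Y : TangentSpace 𝓘(ℝ, Plane) p) :
    h.inner p X Y = ∑ k, h.inner p X (S.frame a k p) * h.inner p Y (S.frame a k p) := by
  conv_lhs => rw [S.eq_sum_inner_smul_frame hp Y]
  simp only [map_sum, map_smul, smul_eq_mul, mul_comm]

theorem eventuallyEq_inner_smul_frame (hp : p ∈ S.baseSet a)
    (V : (r : M) → TangentSpace 𝓘(ℝ, Plane) r) :
    V =ᶠ[nhds p] (fun r => h.inner r (V r) (S.frame a 0 r)) • S.frame a 0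
      + (fun r => h.inner r (V r) (S.frame a 1 r)) • S.frame a 1 := by
  filter_upwards [(S.isOpen_baseSet a).mem_nhds hp] with r hr
  exact (S.eq_sum_inner_smul_frame hr (V r)).trans (Fin.sum_univ_two _)

variable {V W : (r : M) → TangentSpace 𝓘(ℝ, Plane) r}

theorem mdifferentiableAt_inner_frame (hp : p ∈ S.baseSet a)
    (hV : MDifferentiableAt 𝓘(ℝ, Plane) 𝓘(ℝ, Plane).tangent (T% V) p) (k : Fin 2) :
    MDifferentiableAt 𝓘(ℝ, Plane) 𝓘(ℝ, ℝ) (fun r => h.inner r (V r) (S.frame a k r)) p :=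
  mdifferentiableAt_riemannianMetric_inner h (by simp) hV (S.mdifferentiableAt_frame hp k)

theorem cartan_structure_equation (hp : p ∈ S.baseSet a)
    (hV : MDifferentiableAt 𝓘(ℝ, Plane) 𝓘(ℝ, Plane).tangent (T% V) p)
    (hW : MDifferentiableAt 𝓘(ℝ, Plane) 𝓘(ℝ, Plane).tangent (T% W) p) (k : Fin 2) :
    mvfderiv 𝓘(ℝ, Plane) (fun r => h.inner r (W r) (S.frame a k r)) p (V p)
        - mvfderiv 𝓘(ℝ, Plane) (fun r => h.inner r (V r) (S.frame a k r)) p (W p)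
      = h.inner p (mlieBracket 𝓘(ℝ, Plane) V W p) (S.frame a k p)
        + S.areaForm a p (V p) (W p) * S.connForm a p (S.frame a k p) := by
  have hVe := S.eventuallyEq_inner_smul_frame hp V
  have hWe := S.eventuallyEq_inner_smul_frame hp W
  rw [hVe.mlieBracket_vectorField_eq hWe, mlieBracket_linearCombination
    (S.mdifferentiableAt_frame hp 0) (S.mdifferentiableAt_frame hp 1)
    (S.mdifferentiableAt_inner_frame hp hV 0) (S.mdifferentiableAt_inner_frame hp hV 1)
    (S.mdifferentiableAt_inner_frame hp hW 0) (S.mdifferentiableAt_inner_frame hp hW 1)]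
  have hVp := hVe.eq_of_nhds
  have hWp := hWe.eq_of_nhds
  simp only [Pi.add_apply, Pi.smul_apply'] at hVp hWp
  rw [← hVp, ← hWp]
  simp only [map_add, map_smul, add_apply, smul_apply, S.orthonormal a p hp, areaForm, connForm,
    smul_eq_mul]
  fin_cases k <;> simp

theorem mvfderiv_eq_sum_frame (hp : p ∈ S.baseSet a) {F : Type*} [NormedAddCommGroup F]
    [NormedSpace ℝ F] (f : M → F) (X : TangentSpace 𝓘(ℝ, Plane) p) :
    mvfderiv 𝓘(ℝ, Plane) f p X
      = ∑ k, h.inner p X (S.frame a k p) • mvfderiv 𝓘(ℝ, Plane) f p (S.frame a k p) := by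
  conv_lhs => rw [S.eq_sum_inner_smul_frame hp X]
  simp only [map_sum, map_smul]

theorem cliff_frame (p : M) (k : Fin 2) (φ : Spinor) :
    S.cliff p (S.frame (S.indexAt p) k p) φ = gam k *ᵥ φ := by
  simp only [cliff, S.orthonormal _ p (S.mem_baseSet_at p), ite_smul, one_smul, zero_smul,
    Finset.sum_ite_eq, Finset.mem_univ, if_true]

theorem cliff_cliff (p : M) (X Y : TangentSpace 𝓘(ℝ, Plane) p) (φ : Spinor) :
    S.cliff p X (S.cliff p Y φ)
      = S.areaForm (S.indexAt p) p X Y • (gam 0 * gam 1) *ᵥ φ - h.inner p X Y • φ := by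
  rw [S.inner_eq_sum (S.mem_baseSet_at p) X Y]
  simp only [cliff, areaForm, Fin.sum_univ_two, Matrix.mulVec_add, Matrix.mulVec_smul,
    Matrix.mulVec_mulVec, gam_mul_self, gam_one_mul_gam_zero, Matrix.neg_mulVec,
    Matrix.one_mulVec]
  module

theorem volumeElement_eq (p : M) (φ : Spinor) : S.volumeElement p φ = ![-φ 0, φ 1] := by
  rw [volumeElement, cliff_frame, cliff_frame, gam_one_mulVec, gam_zero_mulVec]
  ext k
  fin_cases k <;> simp [← mul_assoc]

theorem projPlus_eq (p : M) (φ : Spinor) : S.projPlus p φ = ![0, φ 1] := by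
  rw [projPlus, volumeElement_eq]
  ext k
  fin_cases k
  · change (1 / 2 : ℂ) * (φ 0 + -φ 0) = 0
    ring
  · change (1 / 2 : ℂ) * (φ 1 + φ 1) = φ 1
    ring

theorem projMinus_eq (p : M) (φ : Spinor) : S.projMinus p φ = ![φ 0, 0] := by
  rw [projMinus, volumeElement_eq]
  ext k
  fin_cases k
  · change (1 / 2 : ℂ) * (φ 0 - -φ 0) = φ 0
    ring
  · change (1 / 2 : ℂ) * (φ 1 - φ 1) = 0
    ring

theorem herm_cliff_commutator (p : M) (X Y : TangentSpace 𝓘(ℝ, Plane) p) (x y z : Spinor) :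
    herm x (S.cliff p X z) * herm z (S.cliff p Y y)
        - herm x (S.cliff p Y z) * herm z (S.cliff p X y)
      = S.areaForm (S.indexAt p) p X Y * (2 * normSq z * herm x ((gam 0 * gam 1) *ᵥ y)
        + 2 * Complex.I
          * (normSq (S.projMinus p z) * herm (S.projMinus p x) (S.projMinus p y)
            - normSq (S.projPlus p z) * herm (S.projPlus p x) (S.projPlus p y))) := by
  have hfierz :
      herm x (gam 0 *ᵥ z) * herm z (gam 1 *ᵥ y) - herm x (gam 1 *ᵥ z) * herm z (gam 0 *ᵥ y)
      = 2 * normSq z * herm x ((gam 0 * gam 1) *ᵥ y) + 2 * Complex.I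
          * (normSq (S.projMinus p z) * herm (S.projMinus p x) (S.projMinus p y)
            - normSq (S.projPlus p z) * herm (S.projPlus p x) (S.projPlus p y)) := by
    rw [gam_commutator_fierz]
    simp [projMinus_eq, projPlus_eq, herm, normSq]
  rw [← hfierz]
  simp only [cliff, areaForm, Fin.sum_univ_two, herm_add_right, herm_smul_right,
    Complex.ofReal_sub, Complex.ofReal_mul]
  ring

section SpinorFields

variable {S} (φ η : S.SpinorField)

theorem comp_eq_spinRep_val (a : ι) (p : M) :
    comp a φ p = spinRep (S.lift a (S.indexAt p) p : ℂ) (val φ p) := by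
  have hcomp (b : ι) : comp b φ p = spinRep (S.lift b (S.indexAt p) p : ℂ) (φ p) := rfl
  have hval : val φ p = φ p := by
    rw [val, hcomp, S.lift_self _ p (S.mem_baseSet_at p), Circle.coe_one]
    exact spinRep_one _
  rw [hval, hcomp]

theorem mdifferentiableAt_comp (hp : p ∈ S.baseSet a) :
    MDifferentiableAt 𝓘(ℝ, Plane) 𝓘(ℝ, Spinor) (comp a φ) p :=
  have : MemTrivializationAtlas (S.spinorBundle.localTriv a) := ⟨a, rfl⟩
  ((Bundle.Trivialization.contMDiffAt_section_iff (S.spinorBundle.localTriv a) hp).1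
    (φ.contMDiff p)).mdifferentiableAt (by simp)

theorem dirac_eq (p : M) :
    dirac φ p = ∑ k, gam k *ᵥ
      (mvfderiv 𝓘(ℝ, Plane) (comp (S.indexAt p) φ) p (S.frame (S.indexAt p) k p)
        + (S.connForm (S.indexAt p) p (S.frame (S.indexAt p) k p) / 2)
          • (gam 0 * gam 1) *ᵥ val φ p) := by
  simp only [dirac, cliff_frame]
  rfl

/-- The one-form `X ↦ ⟨φ, X · η⟩`; the entries of `current` are its values on coordinate fields. -/
def currentForm (p : M) (X : TangentSpace 𝓘(ℝ, Plane) p) : ℂ :=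
  herm (val φ p) (S.cliff p X (val η p))

theorem currentForm_eq_sum (hp : p ∈ S.baseSet a) (X : TangentSpace 𝓘(ℝ, Plane) p) :
    currentForm φ η p X
      = ∑ k, h.inner p X (S.frame a k p) • hermForm (gam k) (comp a φ p) (comp a η p) := by
  have hp' : p ∈ S.baseSet a ∩ S.baseSet (S.indexAt p) := ⟨hp, S.mem_baseSet_at p⟩
  simp only [currentForm, cliff, Fin.sum_univ_two, S.frame_change_zero _ _ p hp',
    S.frame_change_one _ _ p hp', comp_eq_spinRep_val, hermForm_apply,
    herm_spinRep_gam_mulVec_spinRep, gam_zero_mulVec_spinRep, gam_one_mulVec_spinRep, map_add,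
    map_smul, smul_eq_mul, sub_eq_add_neg, herm_add_right, herm_neg_right, herm_smul_right,
    Complex.real_smul, Complex.ofReal_add, Complex.ofReal_mul, Complex.ofReal_neg]
  ring

variable (W) in
theorem eventuallyEq_currentForm (hp : p ∈ S.baseSet a) :
    (fun r => currentForm φ η r (W r)) =ᶠ[nhds p]
      (fun r => h.inner r (W r) (S.frame a 0 r))
          • (fun r => hermForm (gam 0) (comp a φ r) (comp a η r))
        + (fun r => h.inner r (W r) (S.frame a 1 r))
          • (fun r => hermForm (gam 1) (comp a φ r) (comp a η r)) := by
  filter_upwards [(S.isOpen_baseSet a).mem_nhds hp] with r hr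
  exact (currentForm_eq_sum φ η hr (W r)).trans (Fin.sum_univ_two _)

theorem mdifferentiableAt_hermForm_comp (hp : p ∈ S.baseSet a) (k : Fin 2) :
    MDifferentiableAt 𝓘(ℝ, Plane) 𝓘(ℝ, ℂ)
      (fun r => hermForm (gam k) (comp a φ r) (comp a η r)) p :=
  mdifferentiableAt_bilinear _ (mdifferentiableAt_comp φ hp) (mdifferentiableAt_comp η hp)

theorem mdifferentiableAt_currentForm
    (hW : MDifferentiableAt 𝓘(ℝ, Plane) 𝓘(ℝ, Plane).tangent (T% W) p) :
    MDifferentiableAt 𝓘(ℝ, Plane) 𝓘(ℝ, ℂ) (fun r => currentForm φ η r (W r)) p := by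
  have hp := S.mem_baseSet_at p
  have hW_inner := S.mdifferentiableAt_inner_frame hp hW
  have hB := mdifferentiableAt_hermForm_comp φ η hp
  exact (((hW_inner 0).smul (hB 0)).add ((hW_inner 1).smul (hB 1))).congr_of_eventuallyEq
    (eventuallyEq_currentForm W φ η hp)

theorem mvfderiv_currentForm (hp : p ∈ S.baseSet a)
    (hW : MDifferentiableAt 𝓘(ℝ, Plane) 𝓘(ℝ, Plane).tangent (T% W) p)
    (X : TangentSpace 𝓘(ℝ, Plane) p) :
    mvfderiv 𝓘(ℝ, Plane) (fun r => currentForm φ η r (W r)) p X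
      = ∑ k, (mvfderiv 𝓘(ℝ, Plane) (fun r => h.inner r (W r) (S.frame a k r)) p X
            • hermForm (gam k) (comp a φ p) (comp a η p)
          + h.inner p (W p) (S.frame a k p)
            • (hermForm (gam k) (mvfderiv 𝓘(ℝ, Plane) (comp a φ) p X) (comp a η p)
              + hermForm (gam k) (comp a φ p) (mvfderiv 𝓘(ℝ, Plane) (comp a η) p X))) := by
  have hφ := mdifferentiableAt_comp φ hp
  have hη := mdifferentiableAt_comp η hp
  have hW_inner := S.mdifferentiableAt_inner_frame hp hW
  have hB := mdifferentiableAt_hermForm_comp φ η hp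
  rw [mvfderiv, (eventuallyEq_currentForm W φ η hp).mfderiv_eq]
  change mvfderiv 𝓘(ℝ, Plane) _ p X = _
  rw [mvfderiv_add ((hW_inner 0).smul (hB 0)) ((hW_inner 1).smul (hB 1)),
    mvfderiv_smul (hW_inner 0) (hB 0), mvfderiv_smul (hW_inner 1) (hB 1)]
  simp only [Fin.sum_univ_two, mvfderiv_bilinear (hermForm _) hφ hη, add_apply, smul_apply,
    ContinuousLinearMap.smulRight_apply]
  abel

theorem exteriorDeriv_currentForm
    (hV : MDifferentiableAt 𝓘(ℝ, Plane) 𝓘(ℝ, Plane).tangent (T% V) p)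
    (hW : MDifferentiableAt 𝓘(ℝ, Plane) 𝓘(ℝ, Plane).tangent (T% W) p) :
    mvfderiv 𝓘(ℝ, Plane) (fun r => currentForm φ η r (W r)) p (V p)
        - mvfderiv 𝓘(ℝ, Plane) (fun r => currentForm φ η r (V r)) p (W p)
        - currentForm φ η p (mlieBracket 𝓘(ℝ, Plane) V W p)
      = S.areaForm (S.indexAt p) p (V p) (W p)
        * (herm (dirac φ p) ((gam 0 * gam 1) *ᵥ val η p)
          + herm (val φ p) ((gam 0 * gam 1) *ᵥ dirac η p)) := by
  have hp := S.mem_baseSet_at p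
  have hstruct (k : Fin 2) := eq_add_of_sub_eq (S.cartan_structure_equation hp hV hW k)
  rw [dirac_eq, dirac_eq, herm_curl_connection, mvfderiv_currentForm φ η hp hW,
    mvfderiv_currentForm φ η hp hV, currentForm_eq_sum φ η hp,
    S.mvfderiv_eq_sum_frame hp (comp _ φ) (V p), S.mvfderiv_eq_sum_frame hp (comp _ η) (V p),
    S.mvfderiv_eq_sum_frame hp (comp _ φ) (W p), S.mvfderiv_eq_sum_frame hp (comp _ η) (W p)]
  simp only [hstruct, Fin.sum_univ_two, areaForm, val, map_add, map_smul, add_apply, smul_apply,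
    hermForm_apply, Complex.real_smul, Complex.ofReal_add, Complex.ofReal_sub, Complex.ofReal_mul]
  ring

end SpinorFields

section GrossNeveuFields

variable {S} {q : ℕ} (ψ : Fin q → S.SpinorField) (c : OpenPartialHomeomorph M Plane)

/-- The difference of the two sides of the Majorana condition, as a matrix in the indices `i`, `m`:
`∑ⱼ (|P₋ψʲ|² ⟨P₋ψⁱ, P₋ψᵐ⟩ - |P₊ψʲ|² ⟨P₊ψⁱ, P₊ψᵐ⟩)`. -/
def majoranaDefect (p : M) : Matrix (Fin q) (Fin q) ℂ :=
  Matrix.of fun i m => ∑ j,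
    (normSq (S.projMinus p (val (ψ j) p))
        * herm (S.projMinus p (val (ψ i) p)) (S.projMinus p (val (ψ m) p))
      - normSq (S.projPlus p (val (ψ j) p))
        * herm (S.projPlus p (val (ψ i) p)) (S.projPlus p (val (ψ m) p)))

theorem majoranaDefect_apply_eq_zero_iff (p : M) (i m : Fin q) :
    majoranaDefect ψ p i m = 0 ↔ MajoranaAt ψ i m p := by
  simp only [majoranaDefect, Matrix.of_apply, Finset.sum_sub_distrib, sub_eq_zero, MajoranaAt,
    Complex.ofReal_sum, Finset.sum_mul]

variable {c}

theorem matrixDeriv_current_apply (hc : c ∈ IsManifold.maximalAtlas 𝓘(ℝ, Plane) ∞ M)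
    (hp : p ∈ c.source) (k l : Fin 2) (i m : Fin q) :
    matrixDeriv c k (current ψ c l) p i m
      = mvfderiv 𝓘(ℝ, Plane) (fun r => currentForm (ψ i) (ψ m) r (coordField c l r)) p
          (coordField c k p) :=
  (mvfderiv_mpullback_constField (mdifferentiable_of_mem_maximalAtlas hc (by simp)) hp
    (mdifferentiableAt_currentForm _ _ (mdifferentiableAt_coordField hc hp l)) _).symm

theorem curl_current_apply (hc : c ∈ IsManifold.maximalAtlas 𝓘(ℝ, Plane) ∞ M)
    (hp : p ∈ c.source) (i m : Fin q) :
    (matrixDeriv c 0 (current ψ c 1) p - matrixDeriv c 1 (current ψ c 0) p) i m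
      = S.areaForm (S.indexAt p) p (coordField c 0 p) (coordField c 1 p)
        * (herm (dirac (ψ i) p) ((gam 0 * gam 1) *ᵥ val (ψ m) p)
          + herm (val (ψ i) p) ((gam 0 * gam 1) *ᵥ dirac (ψ m) p)) := by
  rw [← exteriorDeriv_currentForm _ _ (mdifferentiableAt_coordField hc hp 0)
    (mdifferentiableAt_coordField hc hp 1), mlieBracket_coordField hc hp, Matrix.sub_apply,
    matrixDeriv_current_apply ψ hc hp, matrixDeriv_current_apply ψ hc hp]
  simp [currentForm, cliff, herm]

variable (c) in
theorem commutator_current_apply (p : M) (i m : Fin q) :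
    (current ψ c 0 p * current ψ c 1 p - current ψ c 1 p * current ψ c 0 p) i m
      = S.areaForm (S.indexAt p) p (coordField c 0 p) (coordField c 1 p)
        * (2 * totalNormSq ψ p * herm (val (ψ i) p) ((gam 0 * gam 1) *ᵥ val (ψ m) p)
          + 2 * Complex.I * majoranaDefect ψ p i m) := by
  simp only [Matrix.sub_apply, Matrix.mul_apply, current, Matrix.of_apply,
    ← Finset.sum_sub_distrib, S.herm_cliff_commutator, ← Finset.mul_sum, Finset.sum_add_distrib,
    ← Finset.sum_mul, majoranaDefect, totalNormSq, Complex.ofReal_sum]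

end GrossNeveuFields

end SpinStructure

end GrossNeveu

end

open GrossNeveu SpinStructure in
theorem mainTheorem11_general {M : Type*} [TopologicalSpace M] [ChartedSpace Plane M]
    [IsManifold 𝓘(ℝ, Plane) ∞ M] (h : SurfaceMetric M) {ι : Type*} (S : SpinStructure h ι) {q : ℕ}
    (ψ : Fin q → S.SpinorField) (lam κ : ℝ) (p : M)
    (hψ : ∀ i, dirac (ψ i) p = lam • val (ψ i) p + (κ * totalNormSq ψ p) • val (ψ i) p)
    (c : OpenPartialHomeomorph M Plane) (hc : c ∈ IsManifold.maximalAtlas 𝓘(ℝ, Plane) ∞ M)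
    (hp : p ∈ c.source) (i m : Fin q) :
    (matrixDeriv c 0 (current ψ c 1) p - matrixDeriv c 1 (current ψ c 0) p
        - (κ : ℂ) • (current ψ c 0 p * current ψ c 1 p
          - current ψ c 1 p * current ψ c 0 p)) i m
      = 2 * lam * (herm (val (ψ i) p)
            (S.cliff p (coordField c 0 p) (S.cliff p (coordField c 1 p) (val (ψ m) p)))
          + h.inner p (coordField c 0 p) (coordField c 1 p)
            * herm (val (ψ i) p) (val (ψ m) p))
        - 2 * Complex.I * κ
          * S.areaForm (S.indexAt p) p (coordField c 0 p) (coordField c 1 p)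
          * majoranaDefect ψ p i m := by
  rw [Matrix.sub_apply, Matrix.smul_apply, curl_current_apply ψ hc hp,
    commutator_current_apply ψ c p, hψ i, hψ m, S.cliff_cliff]
  simp only [herm_add_left, herm_smul_left, Matrix.mulVec_add, Matrix.mulVec_smul,
    herm_add_right, herm_smul_right, sub_eq_add_neg, herm_neg_right, smul_eq_mul,
    Complex.ofReal_mul]
  ring

open scoped Manifold ContDiff in
open GrossNeveu SpinStructure in
theorem mainTheorem11 {M : Type*} [TopologicalSpace M] [ChartedSpace Plane M]
    [IsManifold 𝓘(ℝ, Plane) ∞ M] (h : SurfaceMetric M) {ι : Type*} (S : SpinStructure h ι) {q : ℕ}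
    (ψ : Fin q → S.SpinorField) (lam κ : ℝ) (hψ : IsGrossNeveuSolution lam κ ψ)
    (c : OpenPartialHomeomorph M Plane) (hc : c ∈ IsManifold.maximalAtlas 𝓘(ℝ, Plane) ∞ M)
    (p : M) (hp : p ∈ c.source) :
    (∀ i m : Fin q, MajoranaAt ψ i m p →
      h.inner p (coordField c 0 p) (coordField c 1 p) = 0 →
      (matrixDeriv c 0 (current ψ c 1) p - matrixDeriv c 1 (current ψ c 0) p
          - (κ : ℂ) • (current ψ c 0 p * current ψ c 1 p
            - current ψ c 1 p * current ψ c 0 p)) i m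
        = 2 * (lam : ℂ) * herm (val (ψ i) p)
            (S.cliff p (coordField c 0 p) (S.cliff p (coordField c 1 p) (val (ψ m) p)))) ∧
    (lam = 0 → (∀ i m : Fin q, MajoranaAt ψ i m p) →
      matrixDeriv c 0 (current ψ c 1) p - matrixDeriv c 1 (current ψ c 0) p
          - (κ : ℂ) • (current ψ c 0 p * current ψ c 1 p
            - current ψ c 1 p * current ψ c 0 p) = 0 ∧
      curvature c (fun k r => -(κ : ℂ) • current ψ c k r) p = 0) := by
  have key := mainTheorem11_general h S ψ lam κ p (fun i => hψ i p) c hc hp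
  refine ⟨fun i m hM horth => ?_, fun hlam hM => ?_⟩
  · rw [key, (majoranaDefect_apply_eq_zero_iff ψ p i m).2 hM, horth]
    simp
  · refine (and_iff_left_of_imp fun hflat => ?_).2 (Matrix.ext fun i m => ?_)
    · rw [curvature_neg_smul, hflat, smul_zero]
    · rw [key, (majoranaDefect_apply_eq_zero_iff ψ p i m).2 (hM i m), hlam]
      simp
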